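/- Let $F$ be a division ring, $\sigma:F\to F$ a ring endomorphism (with $\sigma(1)=1$) and $\delta:F\to F$ a $\sigma$-derivation, i.e. an additive map with $\delta(ab)=\sigma(a)\delta(b)+\delta(a)b$ for all $a,b\in F$. Let $R=F[x;\sigma,\delta]$ be the Ore extension: the ring of polynomials $\sum_i a_ix^i$ with left coefficients $a_i\in F$, the usual addition, and the multiplication determined by $xa=\sigma(a)x+\delta(a)$ for $a\in F$. For integers $d,s\ge 0$ and $a\in F$ let $\mathcal C_{d,s}(a)$ be the sum of the values at $a$ of all $\binom{d+s}{d}$ compositions of $d$ copies of $\delta$ and $s$ copies of $\sigma$ (so $\mathcal C_{0,0}(a)=a$). For $f=\sum_{j=0}^m a_jx^j$ and $g=\sum_{j=0}^n b_jx^j$ in $R$ of degrees $m$ and $n$ (so $a_m\ne 0$, $b_n\neq 0$), put $a_j=0$ for $j<0$ or $j>m$, and $b_j=0$ for $j<0$ or $j>n$. The right $(\sigma,\delta)$-Sylvester matrix $\mathrm{Sylv}(f,g)$ is the $(m+n)\times(m+n)$ matrix whose first $n$ rows are $$\Big(\sum_{l=0}^{p}\mathcal C_{p-l,l}(a_{q-l})\Big)_{0\le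 q\le m+n-1},\qquad p=0,\dots,n-1,$$ and whose last $m$ rows are $$\Big(\sum_{l=0}^{p}\mathcal C_{p-l,l}(b_{q-l})\Big)_{0\le q\le m+n-1},\qquad p=0,\dots,m-1.$$ The right $(\sigma,\delta)$-resultant $R_F^{\sigma,\delta}(f,g)\in\{0\}\cup F^*/[F^*,F^*]$ is the Dieudonné determinant of $\mathrm{Sylv}(f,g)$. A right factor of $f$ is an $h\in R$ with $f=qh$ for some $q\in R$. A greatest common right divisor of $f$ and $g$ is a common right factor of $f$ and $g$ of which every common right factor of $f$ and $g$ is a right factor; it exists, and for $f,g$ not both zero $\mathrm{gcrd}(f,g)$ denotes the unique monic one. **Theorem.** Let $f,g\in R$ be non-constant skew polynomials. The following conditions are equivalent: 1. $R_F^{\sigma,\delta}(f,g)=0$; 2. $f$ and $g$ have a common right factor in $R$ that is not a unit; 3. $\mathrm{gcrd}(f,g)\neq 1$; 4. there are no $p,q\in R$ such that $pf+qg=1$; 5. $Rf+Rg\subsetneq R$. -/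

import Mathlib

noncomputable section

/-- A `σ`-derivation of a division ring `F`: an additive map `δ` with
`δ (a b) = σ(a) δ(b) + δ(a) b`. -/
structure SkewDerivation {F : Type*} [DivisionRing F] (σ : F →+* F) extends F →+ F where
  leibniz : ∀ a b : F, toFun (a * b) = σ a * toFun b + toFun a * b

/-- The underlying additive group of the Ore extension `F[x;σ,δ]`: finitely supported coefficient
sequences, where `f` stands for `∑ i, (f i) x ^ i` (coefficients on the left). -/
def OreExtension {F : Type*} [DivisionRing F] (σ : F →+* F) (_δ : SkewDerivation σ) : Type _ :=
  ℕ →₀ F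

namespace OreExtension

variable {F : Type*} [DivisionRing F] {σ : F →+* F} {δ : SkewDerivation σ}

instance : AddCommGroup (OreExtension σ δ) := inferInstanceAs (AddCommGroup (ℕ →₀ F))

instance : Module F (OreExtension σ δ) := inferInstanceAs (Module F (ℕ →₀ F))

/-- The coefficient of `x ^ i`. -/
def coeff (f : OreExtension σ δ) (i : ℕ) : F := (show ℕ →₀ F from f) i

/-- The monomial `a x ^ i`, as an additive function of `a`. -/
def monomial (i : ℕ) : F →+ OreExtension σ δ := Finsupp.singleAddHom (M := F) i

/-- The additive map out of `F[x;σ,δ]` with prescribed values on the monomials. -/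
def lift {M : Type*} [AddCommMonoid M] (φ : ℕ → (F →+ M)) : OreExtension σ δ →+ M :=
  Finsupp.liftAddHom (M := F) φ

/-- Left multiplication by `x`: it sends `a x ^ i` to `σ(a) x ^ (i + 1) + δ(a) x ^ i`. -/
def xMul : AddMonoid.End (OreExtension σ δ) :=
  lift fun i => (monomial (i + 1)).comp (σ : F →+ F) + (monomial i).comp δ.toAddMonoidHom

/-- Left multiplication by a polynomial: `∑ i, a_i x ^ i` acts as `∑ i, a_i • xMul ^ i`. -/
def leftMul : OreExtension σ δ →+ AddMonoid.End (OreExtension σ δ) :=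
  lift fun i => (AddMonoidHom.mulRight (xMul ^ i)).comp
    (Module.toAddMonoidEnd F (OreExtension σ δ) : F →+ AddMonoid.End (OreExtension σ δ))

instance : Mul (OreExtension σ δ) := ⟨fun f g => leftMul f g⟩

instance : One (OreExtension σ δ) := ⟨monomial 0 1⟩

theorem mul_def (f g : OreExtension σ δ) : f * g = leftMul f g := rfl

theorem one_def : (1 : OreExtension σ δ) = monomial 0 1 := rfl

@[ext] theorem ext {f g : OreExtension σ δ} (h : ∀ i, coeff f i = coeff g i) : f = g :=
  Finsupp.ext h

theorem lift_monomial {M : Type*} [AddCommMonoid M] (φ : ℕ → (F →+ M)) (i : ℕ) (a : F) :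
    lift φ (monomial i a : OreExtension σ δ) = φ i a :=
  Finsupp.liftAddHom_apply_single (M := F) φ i a

theorem induction_on {p : OreExtension σ δ → Prop} (f : OreExtension σ δ) (h0 : p 0)
    (hadd : ∀ f g, p f → p g → p (f + g)) (hm : ∀ i a, p (monomial i a)) : p f :=
  Finsupp.induction_linear (M := F) f h0 hadd hm

theorem smul_monomial (a b : F) (i : ℕ) :
    a • (monomial i b : OreExtension σ δ) = monomial i (a * b) :=
  Finsupp.smul_single a i b

theorem xMul_monomial (i : ℕ) (a : F) :
    xMul (monomial i a : OreExtension σ δ) = monomial (i + 1) (σ a) + monomial i (δ.toFun a) :=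
  lift_monomial _ i a

theorem leftMul_monomial (i : ℕ) (a : F) (g : OreExtension σ δ) :
    leftMul (monomial i a) g = a • (xMul ^ i) g := by
  unfold leftMul
  rw [lift_monomial]
  rfl

theorem derivation_one : δ.toFun 1 = 0 := by
  have h := δ.leibniz 1 1
  simpa using h

theorem xMul_smul (a : F) (g : OreExtension σ δ) :
    xMul (a • g) = σ a • xMul g + δ.toFun a • g := by
  induction g using induction_on with
  | h0 => simp
  | hadd f g hf hg => simp only [smul_add, map_add, hf, hg]; abel
  | hm i b =>
    simp only [smul_monomial, xMul_monomial, smul_add, δ.leibniz, map_mul, map_add]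
    abel

theorem leftMul_add (f g h : OreExtension σ δ) :
    leftMul (f + g) h = leftMul f h + leftMul g h := by
  rw [map_add]; rfl

theorem leftMul_zero (h : OreExtension σ δ) : leftMul 0 h = 0 := by
  rw [map_zero]; rfl

theorem leftMul_xMul (g h : OreExtension σ δ) : leftMul (xMul g) h = xMul (leftMul g h) := by
  induction g using induction_on with
  | h0 => simp
  | hadd f g hf hg => rw [map_add xMul, leftMul_add, leftMul_add, map_add xMul, hf, hg]
  | hm i b =>
    rw [xMul_monomial, leftMul_add]
    simp only [leftMul_monomial, xMul_smul, pow_succ']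
    rfl

theorem leftMul_smul (a : F) (g h : OreExtension σ δ) :
    leftMul (a • g) h = a • leftMul g h := by
  induction g using induction_on with
  | h0 => simp
  | hadd f g hf hg => simp only [smul_add, leftMul_add, hf, hg]
  | hm i b => rw [smul_monomial, leftMul_monomial, leftMul_monomial, mul_smul]

theorem xMul_pow_one (i : ℕ) : (xMul ^ i) (1 : OreExtension σ δ) = monomial i 1 := by
  induction i with
  | zero => rfl
  | succ i ih =>
    rw [pow_succ']
    change xMul ((xMul ^ i) 1) = _
    rw [ih, xMul_monomial, derivation_one]
    simp

theorem leftMul_xMul_pow (i : ℕ) (g h : OreExtension σ δ) :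
    leftMul ((xMul ^ i) g) h = (xMul ^ i) (leftMul g h) := by
  induction i with
  | zero => rfl
  | succ i ih =>
    rw [pow_succ']
    change leftMul (xMul ((xMul ^ i) g)) h = xMul ((xMul ^ i) (leftMul g h))
    rw [leftMul_xMul, ih]

/-- The Ore extension `F[x;σ,δ]` as a ring. -/
instance : Ring (OreExtension σ δ) :=
  { (inferInstance : AddCommGroup (OreExtension σ δ)),
    (inferInstance : Mul (OreExtension σ δ)),
    (inferInstance : One (OreExtension σ δ)) with
    left_distrib := fun f g h => map_add (leftMul f) g h
    right_distrib := leftMul_add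
    zero_mul := leftMul_zero
    mul_zero := fun f => map_zero (leftMul f)
    one_mul := fun f => by
      rw [mul_def, one_def, leftMul_monomial, one_smul]; rfl
    mul_one := fun f => by
      rw [mul_def]
      induction f using induction_on with
      | h0 => rw [leftMul_zero]
      | hadd f g hf hg => rw [leftMul_add, hf, hg]
      | hm i b => rw [leftMul_monomial, xMul_pow_one, smul_monomial, mul_one]
    mul_assoc := fun f g h => by
      simp only [mul_def]
      induction f using induction_on with
      | h0 => simp only [leftMul_zero]
      | hadd f f' hf hf' => simp only [leftMul_add, hf, hf']
      | hm i b => rw [leftMul_monomial, leftMul_monomial, leftMul_smul, leftMul_xMul_pow] }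

/-- The constant polynomial `a`. -/
def C (a : F) : OreExtension σ δ := monomial 0 a

/-- The variable `x`. -/
def X : OreExtension σ δ := monomial 1 1

theorem C_mul (a : F) (f : OreExtension σ δ) : C a * f = a • f := leftMul_monomial 0 a f

theorem X_mul (f : OreExtension σ δ) : X * f = xMul f := by
  rw [X, mul_def, leftMul_monomial, one_smul, pow_one]

/-- The defining commutation rule `x a = σ(a) x + δ(a)`. -/
theorem X_mul_C (a : F) : (X * C a : OreExtension σ δ) = C (σ a) * X + C (δ.toFun a) := by
  rw [X_mul, C, xMul_monomial, C_mul, X, smul_monomial, mul_one, C]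

theorem X_pow_mul (i : ℕ) (f : OreExtension σ δ) : X ^ i * f = (xMul ^ i) f := by
  induction i with
  | zero => rw [pow_zero, one_mul]; rfl
  | succ i ih => rw [pow_succ', mul_assoc, X_mul, ih, pow_succ']; rfl

/-- The monomial `a x ^ i` is the product of `a` and the `i`-th power of `x`. -/
theorem C_mul_X_pow (a : F) (i : ℕ) : (C a * X ^ i : OreExtension σ δ) = monomial i a := by
  rw [C_mul, ← mul_one (X ^ i), X_pow_mul, xMul_pow_one, smul_monomial, mul_one]

/-- The degree of a nonzero polynomial (and `0` for the zero polynomial). -/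
def natDegree (f : OreExtension σ δ) : ℕ := (show ℕ →₀ F from f).support.sup id

/-- A polynomial is monic if its leading coefficient is `1`. -/
def Monic (f : OreExtension σ δ) : Prop := coeff f (natDegree f) = 1

/-- `h` is a right factor (right divisor) of `f`: `f = q h` for some `q`. -/
def IsRightFactor (h f : OreExtension σ δ) : Prop := ∃ q, f = q * h

/-- `d` is a greatest common right divisor of `f` and `g`: a common right divisor that is
right-divisible by every common right divisor. -/
def IsGCRD (f g d : OreExtension σ δ) : Prop :=
  IsRightFactor d f ∧ IsRightFactor d g ∧
    ∀ e, IsRightFactor e f → IsRightFactor e g → IsRightFactor e d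

theorem coeff_add (f g : OreExtension σ δ) (i : ℕ) : coeff (f + g) i = coeff f i + coeff g i :=
  Finsupp.add_apply (M := F) f g i

theorem coeff_sub (f g : OreExtension σ δ) (i : ℕ) : coeff (f - g) i = coeff f i - coeff g i :=
  Finsupp.sub_apply (G := F) f g i

theorem coeff_smul (a : F) (f : OreExtension σ δ) (i : ℕ) : coeff (a • f) i = a * coeff f i :=
  Finsupp.smul_apply (M := F) a f i

theorem coeff_zero (i : ℕ) : coeff (0 : OreExtension σ δ) i = 0 := rfl

theorem coeff_monomial (i j : ℕ) (a : F) :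
    coeff (monomial i a : OreExtension σ δ) j = if i = j then a else 0 :=
  Finsupp.single_apply (M := F)

theorem le_natDegree {f : OreExtension σ δ} {i : ℕ} (h : coeff f i ≠ 0) : i ≤ natDegree f :=
  Finset.le_sup (f := id) (Finsupp.mem_support_iff.2 h)

theorem coeff_natDegree_ne_zero {f : OreExtension σ δ} (h : f ≠ 0) :
    coeff f (natDegree f) ≠ 0 := by
  have hne : (show ℕ →₀ F from f).support.Nonempty := Finsupp.support_nonempty_iff.2 h
  obtain ⟨i, hi, he⟩ := Finset.exists_mem_eq_sup _ hne id
  have : natDegree f = i := he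
  rw [this]
  exact Finsupp.mem_support_iff.1 hi

theorem coeff_xMul (f : OreExtension σ δ) (i : ℕ) :
    coeff (xMul f) i = (if i = 0 then 0 else σ (coeff f (i - 1))) + δ.toFun (coeff f i) := by
  have d0 : δ.toFun 0 = 0 := δ.map_zero'
  have dadd : ∀ a b, δ.toFun (a + b) = δ.toFun a + δ.toFun b := δ.map_add'
  induction f using induction_on with
  | h0 => simp [coeff_zero, d0]
  | hadd f g hf hg =>
    rw [map_add, coeff_add, hf, hg, coeff_add, coeff_add, dadd]
    split_ifs
    · abel
    · rw [map_add]; abel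
  | hm j a =>
    rw [xMul_monomial, coeff_add, coeff_monomial, coeff_monomial, coeff_monomial, coeff_monomial]
    rcases i with _ | i
    · simp [apply_ite δ.toFun, d0]
    · simp [apply_ite δ.toFun, d0, apply_ite σ]

/-- Multiplying on the left by `x ^ k` raises the degree by `k` and applies `σ ^ k` to the leading
coefficient; only non-vanishing is recorded. -/
theorem coeff_xMul_pow {g : OreExtension σ δ} {n : ℕ} (hn : coeff g n ≠ 0)
    (hg : ∀ i, n < i → coeff g i = 0) (k : ℕ) :
    coeff ((xMul ^ k) g) (n + k) ≠ 0 ∧ ∀ i, n + k < i → coeff ((xMul ^ k) g) i = 0 := by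
  have d0 : δ.toFun 0 = 0 := δ.map_zero'
  induction k with
  | zero => exact ⟨hn, hg⟩
  | succ k ih =>
    rw [pow_succ']
    change coeff (xMul ((xMul ^ k) g)) (n + (k + 1)) ≠ 0 ∧
      ∀ i, n + (k + 1) < i → coeff (xMul ((xMul ^ k) g)) i = 0
    refine ⟨?_, fun i hi => ?_⟩
    · rw [coeff_xMul, ih.2 (n + (k + 1)) (by omega), d0, add_zero, if_neg (by omega)]
      simpa using ih.1
    · rw [coeff_xMul, ih.2 i (by omega), ih.2 (i - 1) (by omega), d0]
      simp

/-- Right division with remainder. -/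
theorem exists_quotient {g : OreExtension σ δ} (hg : g ≠ 0) (f : OreExtension σ δ) :
    ∃ q, ∀ i, natDegree g ≤ i → coeff (f - q * g) i = 0 := by
  have hlc := coeff_natDegree_ne_zero hg
  have hhi : ∀ i, natDegree g < i → coeff g i = 0 := fun i hi => by
    by_contra h
    exact absurd (le_natDegree h) (by omega)
  suffices H : ∀ N, ∀ f : OreExtension σ δ, (∀ i, natDegree g + N ≤ i → coeff f i = 0) →
      ∃ q, ∀ i, natDegree g ≤ i → coeff (f - q * g) i = 0 by
    refine H (natDegree f + 1) f fun i hi => ?_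
    by_contra h
    exact absurd (le_natDegree h) (by omega)
  intro N
  induction N with
  | zero => exact fun f hf => ⟨0, fun i hi => by simpa using hf i (by simpa using hi)⟩
  | succ N ih =>
    intro f hf
    obtain ⟨h1, h2⟩ := coeff_xMul_pow hlc hhi N
    obtain ⟨q, hq⟩ := ih
      (f - (coeff f (natDegree g + N) * (coeff ((xMul ^ N) g) (natDegree g + N))⁻¹) •
        (xMul ^ N) g) (fun i hi => by
        rw [coeff_sub, coeff_smul]
        rcases hi.eq_or_lt with rfl | hlt
        · rw [mul_assoc, inv_mul_cancel₀ h1, mul_one, sub_self]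
        · rw [h2 i hlt, hf i (by omega), mul_zero, sub_zero])
    refine ⟨q + monomial N
      (coeff f (natDegree g + N) * (coeff ((xMul ^ N) g) (natDegree g + N))⁻¹), fun i hi => ?_⟩
    rw [add_mul, mul_def (monomial N _), leftMul_monomial, add_comm (q * g), ← sub_sub]
    exact hq i hi

/-- Greatest common right divisors exist, and can be normalised to be monic (or zero, which happens
only for `f = g = 0`). -/
theorem exists_gcrd (f g : OreExtension σ δ) : ∃ d, IsGCRD f g d ∧ (d = 0 ∨ Monic d) := by
  by_cases h0 : f = 0 ∧ g = 0
  · obtain ⟨rfl, rfl⟩ := h0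
    exact ⟨0, ⟨⟨0, by simp⟩, ⟨0, by simp⟩, fun e h _ => h⟩, Or.inl rfl⟩
  have hex : ∃ n, ∃ p q : OreExtension σ δ, p * f + q * g ≠ 0 ∧
      natDegree (p * f + q * g) = n := by
    by_cases hf : f = 0
    · exact ⟨_, 0, 1, by simpa using fun h => h0 ⟨hf, h⟩, rfl⟩
    · exact ⟨_, 1, 0, by simpa using hf, rfl⟩
  classical
  obtain ⟨p, q, hne, hdeg⟩ := Nat.find_spec hex
  have hmin := fun k (hk : k < Nat.find hex) => Nat.find_min hex hk
  have hdvd : ∀ a b, IsRightFactor (p * f + q * g) (a * f + b * g) := by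
    intro a b
    obtain ⟨t, ht⟩ := exists_quotient hne (a * f + b * g)
    refine ⟨t, sub_eq_zero.1 ?_⟩
    by_contra hr
    have e : a * f + b * g - t * (p * f + q * g) = (a - t * p) * f + (b - t * q) * g := by
      rw [mul_add, sub_mul, sub_mul, mul_assoc, mul_assoc]; abel
    have hlt : natDegree (a * f + b * g - t * (p * f + q * g)) < Nat.find hex := by
      rw [← hdeg]
      by_contra hle
      exact coeff_natDegree_ne_zero hr (ht _ (not_lt.1 hle))
    exact hmin _ hlt ⟨_, _, by rwa [← e], by rw [← e]⟩
  have hc := coeff_natDegree_ne_zero hne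
  set h := p * f + q * g with hh
  set c := coeff h (natDegree h)
  have hscale : ∀ k, IsRightFactor h k → IsRightFactor (c⁻¹ • h) k := by
    rintro k ⟨t, rfl⟩
    refine ⟨t * C c, ?_⟩
    rw [mul_assoc, C_mul, smul_smul, mul_inv_cancel₀ hc, one_smul]
  refine ⟨c⁻¹ • h, ⟨hscale f (by simpa using hdvd 1 0), hscale g (by simpa using hdvd 0 1), ?_⟩,
    Or.inr ?_⟩
  · rintro e ⟨u, hu⟩ ⟨v, hv⟩
    refine ⟨C c⁻¹ * (p * u + q * v), ?_⟩
    rw [mul_assoc, C_mul, add_mul, mul_assoc, mul_assoc, ← hu, ← hv]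
  · have hd : natDegree (c⁻¹ • h) = natDegree h := by
      refine le_antisymm ?_ (le_natDegree ?_)
      · apply le_natDegree
        intro hz
        have hne' : c⁻¹ • h ≠ 0 := smul_ne_zero (inv_ne_zero hc) hne
        apply coeff_natDegree_ne_zero hne'
        rw [coeff_smul, hz, mul_zero]
      · rw [coeff_smul]
        exact mul_ne_zero (inv_ne_zero hc) hc
    unfold Monic
    rw [hd, coeff_smul]
    exact inv_mul_cancel₀ hc

/-- The greatest common right divisor of `f` and `g`, normalised to be monic
(and `0` when `f = g = 0`). -/
def gcrd (f g : OreExtension σ δ) : OreExtension σ δ := (exists_gcrd f g).choose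

/-- `𝒞_{d,s}(a)`: the sum of all compositions of `d` copies of `δ` and `s` copies of `σ`, evaluated
at `a`. A composition is a word of length `d + s`, given by the set `S` of the `d` places of `δ`;
the product in `AddMonoid.End F` is composition of maps. -/
def compSum (σ : F →+* F) (δ : SkewDerivation σ) (d s : ℕ) (a : F) : F :=
  ∑ S ∈ Finset.powersetCard d (Finset.univ : Finset (Fin (d + s))),
    (List.ofFn fun i => if i ∈ S then (show AddMonoid.End F from δ.toAddMonoidHom)
      else (show AddMonoid.End F from (σ : F →+ F))).prod a

/-- The entry of the Sylvester matrix in column `q` of the row number `p` (counted from `0`) of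
the block belonging to `f = ∑ a_j x ^ j`, that is `∑_{l = 0}^{p} 𝒞_{p-l,l}(a_{q-l})`, where
`a_j = 0` for `j < 0` and for `j > deg f`. -/
def sylvesterEntry (f : OreExtension σ δ) (p q : ℕ) : F :=
  ∑ l ∈ Finset.range (p + 1), if l ≤ q then compSum σ δ (p - l) l (coeff f (q - l)) else 0

/-- The right `(σ,δ)`-Sylvester matrix of `f` and `g`, of degrees `m` and `n`: the first `n` rows
involve the coefficients of `f`, the last `m` rows those of `g`. -/
def sylvester (f g : OreExtension σ δ) :
    Matrix (Fin (natDegree g + natDegree f)) (Fin (natDegree g + natDegree f)) F :=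
  Matrix.of (Fin.append
    (fun (p : Fin (natDegree g)) (q : Fin (natDegree g + natDegree f)) =>
      sylvesterEntry f (p : ℕ) (q : ℕ))
    (fun (p : Fin (natDegree f)) (q : Fin (natDegree g + natDegree f)) =>
      sylvesterEntry g (p : ℕ) (q : ℕ)))

end OreExtension

section Dieudonne

variable {F : Type*} [DivisionRing F]

open Classical in
/-- The class of `a` in `{0} ∪ Fˣ / [Fˣ, Fˣ]`. -/
def dieudonneClass (a : F) : WithZero (Abelianization Fˣ) :=
  if h : a = 0 then 0 else ((Abelianization.of (Units.mk0 a h) : Abelianization Fˣ) :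
    WithZero (Abelianization Fˣ))

/-- Eliminate the first column of `A` with the pivot `A i 0`: subtract `A r 0 * (A i 0)⁻¹` times
row `i` from every other row `r`, then delete row `i` and the first column. -/
def eliminate {n : ℕ} (A : Matrix (Fin (n + 1)) (Fin (n + 1)) F) (i : Fin (n + 1)) :
    Matrix (Fin n) (Fin n) F :=
  Matrix.of fun r c =>
    A (i.succAbove r) c.succ - A (i.succAbove r) 0 * (A i 0)⁻¹ * A i c.succ

open Classical in
/-- The Dieudonné determinant, with values in `{0} ∪ Fˣ / [Fˣ, Fˣ]`, by elimination with left row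
operations. If the first column is zero, the determinant is `0`. Otherwise let `i` be the first row
with `A i 0 ≠ 0`; clearing the rest of the first column with this pivot does not change the
determinant, moving row `i` to the top contributes the sign `(-1) ^ i`, and one goes on with the
remaining `n × n` block. -/
def dieudonneDet : (n : ℕ) → Matrix (Fin n) (Fin n) F → WithZero (Abelianization Fˣ)
  | 0, _ => 1
  | n + 1, A =>
    if h : ∃ i, A i 0 ≠ 0 then
      dieudonneClass ((-1) ^ (Fin.find (fun i => A i 0 ≠ 0) h : ℕ)) *
        dieudonneClass (A (Fin.find (fun i => A i 0 ≠ 0) h) 0) *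
        dieudonneDet n (eliminate A (Fin.find (fun i => A i 0 ≠ 0) h))
    else 0

end Dieudonne

namespace OreExtension

variable {F : Type*} [DivisionRing F] {σ : F →+* F} {δ : SkewDerivation σ}

/-- The right `(σ,δ)`-resultant: the Dieudonné determinant of the Sylvester matrix. -/
def resultant (f g : OreExtension σ δ) : WithZero (Abelianization Fˣ) :=
  dieudonneDet (natDegree g + natDegree f) (sylvester f g)

end OreExtension

end

/-! Moving `x ^ p` past a coefficient `a` gives `∑ l, 𝒞_{p-l,l}(a) x ^ l`, so the Sylvester rows
list the coefficients of `x ^ p f` and `x ^ p g` (`sylvesterEntry_eq_coeff`). A row vector times the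
matrix is therefore a combination `P f + Q g` with `deg P < deg g` and `deg Q < deg f`. Elimination
shows that the Dieudonné determinant is nonzero iff `v ↦ v A` is injective
(`dieudonneDet_ne_zero_iff`), equivalently surjective, by finite dimension.

If that map is surjective, `1` is such a combination. Conversely, let `u f + w g = 1` and suppose
there were a nontrivial relation `P f + Q g = 0` within the degree bounds. Dividing by `P` would
bring the cofactors of every polynomial of degree below `deg f + deg g` within the bounds, making
the map surjective, hence injective: a contradiction (`vecMul_sylvester_injective_iff`).

The other equivalences use right division, which makes a combination of least degree a common right
factor, and the absence of zero divisors, by which left-invertible elements are units. -/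

noncomputable section

/-! ### Vanishing of the Dieudonné determinant -/

section Dieudonne

variable {F : Type*} [DivisionRing F]

theorem dieudonneClass_ne_zero {a : F} (h : a ≠ 0) : dieudonneClass a ≠ 0 := by
  rw [dieudonneClass, dif_neg h]
  exact WithZero.coe_ne_zero

theorem vecMul_injective_iff {n k : ℕ} (A : Matrix (Fin n) (Fin k) F) :
    Function.Injective (fun v => Matrix.vecMul v A) ↔ ∀ v, Matrix.vecMul v A = 0 → v = 0 :=
  injective_iff_map_eq_zero (Matrix.vecMulLinear A)

theorem vecMul_injective_iff_surjective {n : ℕ} (A : Matrix (Fin n) (Fin n) F) :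
    Function.Injective (fun v => Matrix.vecMul v A) ↔
      Function.Surjective (fun v => Matrix.vecMul v A) :=
  LinearMap.injective_iff_surjective (f := Matrix.vecMulLinear A)

/-- Elimination with a nonzero pivot preserves injectivity of `v ↦ v A`. -/
theorem vecMul_eliminate_injective_iff {n : ℕ} (A : Matrix (Fin (n + 1)) (Fin (n + 1)) F)
    {i : Fin (n + 1)} (hi : A i 0 ≠ 0) :
    Function.Injective (fun v => Matrix.vecMul v (eliminate A i)) ↔
      Function.Injective (fun v => Matrix.vecMul v A) := by
  have expand : ∀ (v : Fin (n + 1) → F) c, Matrix.vecMul v A c =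
      v i * A i c + ∑ r, v (i.succAbove r) * A (i.succAbove r) c := fun v c =>
    Fin.sum_univ_succAbove _ i
  -- The weight given to row `i` is the only one that makes the combined row vanish in column `0`.
  have elim : ∀ (w : Fin n → F) c, Matrix.vecMul w (eliminate A i) c =
      (-(∑ r, w r * A (i.succAbove r) 0) * (A i 0)⁻¹) * A i c.succ +
        ∑ r, w r * A (i.succAbove r) c.succ := by
    intro w c
    simp only [Matrix.vecMul, dotProduct, eliminate, Matrix.of_apply, mul_sub,
      Finset.sum_sub_distrib, neg_mul, Finset.sum_mul, mul_assoc]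
    abel
  rw [vecMul_injective_iff, vecMul_injective_iff]
  constructor
  · intro H v hv
    have h0 : v i = -(∑ r, v (i.succAbove r) * A (i.succAbove r) 0) * (A i 0)⁻¹ := by
      rw [eq_mul_inv_iff_mul_eq₀ hi, eq_neg_iff_add_eq_zero, ← expand v 0, hv]
      rfl
    have hw : (fun r => v (i.succAbove r)) = 0 := by
      apply H
      ext c
      rw [elim, ← h0, ← expand v c.succ, hv]
      rfl
    have hw' : ∀ r, v (i.succAbove r) = 0 := fun r => congrFun hw r
    ext j
    rcases Fin.eq_self_or_eq_succAbove i j with rfl | ⟨r, rfl⟩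
    · simp [h0, hw']
    · exact hw' r
  · intro H w hw
    have hv := H (i.insertNth (-(∑ r, w r * A (i.succAbove r) 0) * (A i 0)⁻¹) w) (by
      ext c
      rw [expand]
      simp only [Fin.insertNth_apply_same, Fin.insertNth_apply_succAbove]
      rcases Fin.eq_zero_or_eq_succ c with rfl | ⟨c, rfl⟩
      · rw [mul_assoc, inv_mul_cancel₀ hi]
        simp
      · rw [← elim, hw]
        rfl)
    ext r
    simpa using congrFun hv (i.succAbove r)

/-- The Dieudonné determinant of `A` vanishes iff the rows of `A` are left dependent. -/
theorem dieudonneDet_ne_zero_iff : ∀ (n : ℕ) (A : Matrix (Fin n) (Fin n) F),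
    dieudonneDet n A ≠ 0 ↔ Function.Injective (fun v => Matrix.vecMul v A)
  | 0, A => by
    simp only [dieudonneDet, ne_eq, one_ne_zero, not_false_eq_true, true_iff]
    exact Function.injective_of_subsingleton _
  | n + 1, A => by
    classical
    rw [dieudonneDet]
    split_ifs with h
    · have hp := Fin.find_spec h
      rw [← vecMul_eliminate_injective_iff A hp, ← dieudonneDet_ne_zero_iff n]
      rw [mul_ne_zero_iff, mul_ne_zero_iff]
      exact ⟨fun h => h.2, fun h => ⟨⟨dieudonneClass_ne_zero (pow_ne_zero _ (by simp)),
        dieudonneClass_ne_zero hp⟩, h⟩⟩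
    -- With a zero first column, no combination of rows has a `1` there, so surjectivity fails.
    · simp only [ne_eq, not_true_eq_false, false_iff, vecMul_injective_iff_surjective]
      intro hs
      obtain ⟨v, hv⟩ := hs (Pi.single 0 1)
      have h0 := congrFun hv 0
      push Not at h
      simp [Matrix.vecMul, dotProduct, h] at h0

end Dieudonne

/-! ### Words in two noncommuting letters -/

/-- The sum of all products of `d` copies of `D` and `n - d` copies of `S`. -/
def wordSum {M : Type*} [Semiring M] (D S : M) (n d : ℕ) : M :=
  ∑ T ∈ Finset.powersetCard d (Finset.univ : Finset (Fin n)),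
    (List.ofFn fun i => if i ∈ T then D else S).prod

theorem wordSum_zero_right {M : Type*} [Semiring M] (D S : M) (n : ℕ) :
    wordSum D S n 0 = S ^ n := by
  simp [wordSum]

theorem wordSum_of_lt {M : Type*} [Semiring M] (D S : M) {n d : ℕ} (h : n < d) :
    wordSum D S n d = 0 := by
  rw [wordSum, Finset.powersetCard_eq_empty.2 (by simpa using h), Finset.sum_empty]

/-- Pascal's rule by the first letter: the set `T` of places of `D` either contains `0` or does not.
-/
theorem wordSum_succ_succ {M : Type*} [Semiring M] (D S : M) (n d : ℕ) :
    wordSum D S (n + 1) (d + 1) = D * wordSum D S n d + S * wordSum D S n (d + 1) := by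
  have hnot : (0 : Fin (n + 1)) ∉ (Finset.univ : Finset (Fin n)).map (Fin.succEmb n) := by
    simp
  have hu : (Finset.univ : Finset (Fin (n + 1))) =
      insert 0 ((Finset.univ : Finset (Fin n)).map (Fin.succEmb n)) := by
    ext i
    rcases Fin.eq_zero_or_eq_succ i with rfl | ⟨i, rfl⟩ <;> simp
  simp only [wordSum]
  rw [hu, Finset.powersetCard_succ_insert hnot, Finset.sum_union, Finset.sum_image, add_comm]
  · simp only [Finset.powersetCard_map, Finset.sum_map, Finset.mul_sum]
    congr 1 <;> refine Finset.sum_congr rfl fun T _ => ?_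
    · simp [List.ofFn_succ]
    · simp [List.ofFn_succ]
  · intro T hT U hU h
    have hT' : (0 : Fin (n + 1)) ∉ T := fun h0 =>
      hnot ((Finset.mem_powersetCard.1 hT).1 h0)
    have hU' : (0 : Fin (n + 1)) ∉ U := fun h0 =>
      hnot ((Finset.mem_powersetCard.1 hU).1 h0)
    rw [← Finset.erase_insert hT', h, Finset.erase_insert hU']
  · rw [Finset.disjoint_left]
    intro T hT hT'
    obtain ⟨U, -, rfl⟩ := Finset.mem_image.1 hT'
    exact hnot ((Finset.mem_powersetCard.1 hT).1 (Finset.mem_insert_self _ _))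

/-! ### Sylvester rows as coefficients of `x ^ p f` -/

namespace OreExtension

variable {F : Type*} [DivisionRing F] {σ : F →+* F} {δ : SkewDerivation σ}

/-- The derivation `δ` as an endomorphism of the additive group of `F`. -/
def derivationEnd (δ : SkewDerivation σ) : AddMonoid.End F := δ.toAddMonoidHom

/-- The ring endomorphism `σ` as an endomorphism of the additive group of `F`. -/
def twistEnd (σ : F →+* F) : AddMonoid.End F := (σ : F →+ F)

/-- Replaces the word length `(p - l) + l`, which occurs in the type of the index sets, by `p`, so
that induction on `p` can use Pascal's rule. -/
theorem compSum_eq_wordSum {p l : ℕ} (h : l ≤ p) (a : F) :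
    compSum σ δ (p - l) l a = wordSum (derivationEnd δ) (twistEnd σ) p (p - l) a := by
  obtain ⟨d, rfl⟩ := Nat.exists_eq_add_of_le' h
  rw [Nat.add_sub_cancel]
  exact (AddMonoidHom.finsetSum_apply _ _ a).symm

/-- The rows of the Sylvester matrix are the coefficients of the `x ^ p f`. -/
theorem sylvesterEntry_eq_coeff (f : OreExtension σ δ) (p q : ℕ) :
    sylvesterEntry f p q = coeff ((xMul ^ p) f) q := by
  have key : ∀ p q, sylvesterEntry f p q = ∑ l ∈ Finset.range (p + 1), if l ≤ q then
      wordSum (derivationEnd δ) (twistEnd σ) p (p - l) (coeff f (q - l)) else 0 :=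
    fun p q => Finset.sum_congr rfl fun l hl => by
      rw [compSum_eq_wordSum (Nat.le_of_lt_succ (Finset.mem_range.1 hl))]
  induction p generalizing q with
  | zero =>
    rw [key]
    simp [wordSum_zero_right]
  | succ p ih =>
    rw [pow_succ']
    change _ = coeff (xMul ((xMul ^ p) f)) q
    rw [coeff_xMul, ← ih, ← ih, key, key, key]
    set D := derivationEnd δ
    set S := twistEnd σ
    have hDa : ∀ a, δ.toFun a = D a := fun _ => rfl
    have hSa : ∀ a, σ a = S a := fun _ => rfl
    rw [hDa, hSa, map_sum, map_sum]
    -- Words beginning with `σ` and with `δ` match the two terms of `coeff_xMul`.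
    have split : ∀ l ∈ Finset.range (p + 1), (if l ≤ q then
        wordSum D S (p + 1) (p + 1 - l) (coeff f (q - l)) else 0) =
        (if l ≤ q then S (wordSum D S p (p + 1 - l) (coeff f (q - l))) else 0) +
          D (if l ≤ q then wordSum D S p (p - l) (coeff f (q - l)) else 0) := by
      intro l hl
      have hl' : p + 1 - l = (p - l) + 1 := by
        have := Finset.mem_range.1 hl
        omega
      split_ifs
      · rw [hl', wordSum_succ_succ, add_comm]
        rfl
      · rw [map_zero, add_zero]
    rw [Finset.sum_range_succ, Finset.sum_congr rfl split, Finset.sum_add_distrib,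
      add_right_comm]
    congr 1
    -- For `l = p + 1` the word contains no `δ`, so only the `σ` part occurs.
    have last : wordSum D S (p + 1) (p + 1 - (p + 1)) = S * wordSum D S p (p + 1 - (p + 1)) := by
      rw [Nat.sub_self, wordSum_zero_right, wordSum_zero_right, pow_succ']
    rw [last]
    change _ + (if p + 1 ≤ q then S (wordSum D S p (p + 1 - (p + 1)) (coeff f (q - (p + 1))))
      else 0) = _
    -- In the `σ` part the term `l = 0` vanishes, as it asks for `p + 1` letters `δ` in a word of
    -- length `p`. Shifting `l` by one then turns column `q` into column `q - 1`.
    rw [← Finset.sum_range_succ (fun l => if l ≤ q then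
      S (wordSum D S p (p + 1 - l) (coeff f (q - l))) else 0), Finset.sum_range_succ',
      wordSum_of_lt D S (show p < p + 1 - 0 by omega)]
    rcases q with _ | q
    · simp
    · rw [if_neg (Nat.succ_ne_zero q)]
      simp [apply_ite S]

/-! ### Coefficient vectors, degrees and units -/

/-- The polynomial with prescribed coefficients in degrees below `n`. -/
def ofVec {n : ℕ} (v : Fin n → F) : OreExtension σ δ := ∑ i : Fin n, monomial (i : ℕ) (v i)

theorem coeff_sum {ι : Type*} (s : Finset ι) (u : ι → OreExtension σ δ) (j : ℕ) :
    coeff (∑ i ∈ s, u i) j = ∑ i ∈ s, coeff (u i) j :=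
  map_sum (AddMonoidHom.mk' (fun f : OreExtension σ δ => coeff f j)
    fun f g => coeff_add f g j) u s

theorem coeff_ofVec {n : ℕ} (v : Fin n → F) (j : Fin n) :
    coeff (ofVec v : OreExtension σ δ) j = v j := by
  simp [ofVec, coeff_sum, coeff_monomial, Fin.val_inj]

theorem coeff_ofVec_of_le {n : ℕ} (v : Fin n → F) {j : ℕ} (h : n ≤ j) :
    coeff (ofVec v : OreExtension σ δ) j = 0 := by
  rw [ofVec, coeff_sum]
  refine Finset.sum_eq_zero fun i _ => ?_
  rw [coeff_monomial, if_neg (by omega)]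

theorem ofVec_coeff {n : ℕ} {f : OreExtension σ δ} (h : ∀ i, n ≤ i → coeff f i = 0) :
    ofVec (fun i : Fin n => coeff f i) = f := by
  ext j
  rcases lt_or_ge j n with hj | hj
  · exact coeff_ofVec (δ := δ) (fun i : Fin n => coeff f i) ⟨j, hj⟩
  · rw [coeff_ofVec_of_le _ hj, h j hj]

theorem ofVec_mul {n : ℕ} (v : Fin n → F) (f : OreExtension σ δ) :
    ofVec v * f = ∑ i : Fin n, v i • (xMul ^ (i : ℕ)) f := by
  rw [ofVec, Finset.sum_mul]
  exact Finset.sum_congr rfl fun i _ => leftMul_monomial _ _ _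

theorem coeff_eq_zero_of_natDegree_lt {f : OreExtension σ δ} {i : ℕ} (h : natDegree f < i) :
    coeff f i = 0 := by
  by_contra hne
  exact absurd (le_natDegree hne) (by omega)

theorem ne_zero_of_natDegree_pos {f : OreExtension σ δ} (h : 0 < natDegree f) : f ≠ 0 := by
  rintro rfl
  exact absurd h (by simp [natDegree, show
    (show ℕ →₀ F from (0 : OreExtension σ δ)) = 0 from rfl])

theorem coeff_xMul_pow_eq_zero (f : OreExtension σ δ) {k i : ℕ} (h : natDegree f + k < i) :
    coeff ((xMul ^ k) f) i = 0 := by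
  by_cases hf : f = 0
  · rw [hf, map_zero, coeff_zero]
  · exact (coeff_xMul_pow (coeff_natDegree_ne_zero hf)
      (fun _ => coeff_eq_zero_of_natDegree_lt) k).2 i h

/-- If `deg p < a` then `deg (p f) < a + deg f`. -/
theorem coeff_mul_eq_zero {a : ℕ} {p f : OreExtension σ δ} (hp : ∀ i, a ≤ i → coeff p i = 0)
    {i : ℕ} (hi : a + natDegree f ≤ i) : coeff (p * f) i = 0 := by
  rw [← ofVec_coeff hp, ofVec_mul, coeff_sum]
  refine Finset.sum_eq_zero fun j _ => ?_
  rw [coeff_smul, coeff_xMul_pow_eq_zero f (by omega), mul_zero]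

/-- Only the top term of `p` reaches this degree, and powers of `σ` keep the leading coefficient of
`f` nonzero. -/
theorem coeff_mul_natDegree_add_ne_zero {p f : OreExtension σ δ} (hp : p ≠ 0) (hf : f ≠ 0) :
    coeff (p * f) (natDegree p + natDegree f) ≠ 0 := by
  have hp' : ∀ i, natDegree p + 1 ≤ i → coeff p i = 0 := fun i hi =>
    coeff_eq_zero_of_natDegree_lt hi
  have e : p * f = ∑ i : Fin (natDegree p + 1), coeff p i • (xMul ^ (i : ℕ)) f := by
    rw [← ofVec_mul, ofVec_coeff hp']
  rw [e, coeff_sum, Fin.sum_univ_castSucc, Finset.sum_eq_zero, zero_add, coeff_smul, Fin.val_last]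
  · refine mul_ne_zero (coeff_natDegree_ne_zero hp) ?_
    rw [add_comm (natDegree p) (natDegree f)]
    exact (coeff_xMul_pow (coeff_natDegree_ne_zero hf)
      (fun _ => coeff_eq_zero_of_natDegree_lt) _).1
  · intro j _
    rw [coeff_smul, coeff_xMul_pow_eq_zero f, mul_zero]
    have := j.2
    simp only [Fin.val_castSucc]
    omega

instance : NoZeroDivisors (OreExtension σ δ) where
  eq_zero_or_eq_zero_of_mul_eq_zero {p f} h := by
    by_contra! hne
    exact coeff_mul_natDegree_add_ne_zero hne.1 hne.2 (by rw [h, coeff_zero])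

theorem coeff_one (i : ℕ) : coeff (1 : OreExtension σ δ) i = if 0 = i then 1 else 0 :=
  coeff_monomial 0 i 1

theorem natDegree_eq_zero_of_mul_eq_one {p f : OreExtension σ δ} (h : p * f = 1) :
    natDegree f = 0 := by
  have h1 : (1 : OreExtension σ δ) ≠ 0 := fun e => by
    simpa [coeff_one, coeff_zero] using congrArg (fun u => coeff u 0) e
  have hp : p ≠ 0 := fun e => h1 (by rw [← h, e, zero_mul])
  have hf : f ≠ 0 := fun e => h1 (by rw [← h, e, mul_zero])
  have := coeff_mul_natDegree_add_ne_zero hp hf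
  rw [h, coeff_one] at this
  by_contra hne
  exact this (if_neg (by omega))

/-- From `p f = 1` follows `(f p - 1) f = 0`, and `f` can be cancelled. -/
theorem isUnit_of_mul_eq_one_left {p f : OreExtension σ δ} (h : p * f = 1) : IsUnit f := by
  have hf : f ≠ 0 := fun e => by
    have h' : (0 : OreExtension σ δ) = 1 := by rw [← h, e, mul_zero]
    simpa [coeff_one, coeff_zero] using congrArg (fun u => coeff u 0) h'
  refine ⟨⟨f, p, sub_eq_zero.1 ?_, h⟩, rfl⟩
  refine (mul_eq_zero.1 (?_ : (f * p - 1) * f = 0)).resolve_right hf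
  rw [sub_mul, mul_assoc, h, mul_one, one_mul, sub_self]

theorem Monic.eq_one_of_isUnit {f : OreExtension σ δ} (hm : Monic f) (hu : IsUnit f) : f = 1 := by
  obtain ⟨u, rfl⟩ := hu
  have h0 := natDegree_eq_zero_of_mul_eq_one u.inv_mul
  unfold Monic at hm
  rw [h0] at hm
  ext i
  rw [coeff_one]
  split_ifs with hi
  · rw [← hi, hm]
  · exact coeff_eq_zero_of_natDegree_lt (by omega)

/-- Some left combination of `f` and `g` is a common right factor of `f` and `g`. -/
theorem exists_combination_isRightFactor {f : OreExtension σ δ} (g : OreExtension σ δ)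
    (hf : f ≠ 0) : ∃ p q : OreExtension σ δ,
      IsRightFactor (p * f + q * g) f ∧ IsRightFactor (p * f + q * g) g := by
  classical
  have hex : ∃ n, ∃ p q : OreExtension σ δ, p * f + q * g ≠ 0 ∧
      natDegree (p * f + q * g) = n := ⟨_, 1, 0, by simpa using hf, rfl⟩
  -- A nonzero combination of least degree: the remainder on dividing another combination by it is
  -- again a combination, of smaller degree if nonzero, hence zero.
  obtain ⟨p, q, hne, hdeg⟩ := Nat.find_spec hex
  have hdvd : ∀ a b, IsRightFactor (p * f + q * g) (a * f + b * g) := by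
    intro a b
    obtain ⟨t, ht⟩ := exists_quotient hne (a * f + b * g)
    refine ⟨t, sub_eq_zero.1 ?_⟩
    by_contra hr
    refine Nat.find_min hex (m := natDegree (a * f + b * g - t * (p * f + q * g))) ?_
      ⟨a - t * p, b - t * q, ?_⟩
    · rw [← hdeg]
      by_contra hle
      exact coeff_natDegree_ne_zero hr (ht _ (not_lt.1 hle))
    · have e : (a - t * p) * f + (b - t * q) * g =
          a * f + b * g - t * (p * f + q * g) := by noncomm_ring
      rw [e]
      exact ⟨hr, rfl⟩
  exact ⟨p, q, by simpa using hdvd 1 0, by simpa using hdvd 0 1⟩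

/-! ### The Sylvester matrix and Bézout identities -/

/-- Multiplying a row vector by the Sylvester matrix computes the coefficients of `p f + q g`. -/
theorem vecMul_sylvester (f g : OreExtension σ δ) (v : Fin (natDegree g + natDegree f) → F)
    (j : Fin (natDegree g + natDegree f)) :
    Matrix.vecMul v (sylvester f g) j =
      coeff (ofVec (fun i => v (Fin.castAdd _ i)) * f + ofVec (fun i => v (Fin.natAdd _ i)) * g :
        OreExtension σ δ) j := by
  rw [coeff_add, ofVec_mul, ofVec_mul, coeff_sum, coeff_sum]
  simp [Matrix.vecMul, dotProduct, Fin.sum_univ_add, sylvester, sylvesterEntry_eq_coeff,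
    coeff_smul]

/-- The combination `p f + q g` given by a row vector has degree less than `deg f + deg g`. -/
theorem coeff_combination_eq_zero {f g p q : OreExtension σ δ}
    (hp : ∀ i, natDegree g ≤ i → coeff p i = 0) (hq : ∀ i, natDegree f ≤ i → coeff q i = 0)
    {j : ℕ} (hj : natDegree g + natDegree f ≤ j) : coeff (p * f + q * g) j = 0 := by
  rw [coeff_add, coeff_mul_eq_zero hp hj, coeff_mul_eq_zero hq (by omega), add_zero]

/-- The rows of the Sylvester matrix span iff `f` and `g` are left comaximal. -/
theorem vecMul_sylvester_injective_iff {f g : OreExtension σ δ} (hf : 0 < natDegree f)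
    (hg : 0 < natDegree g) :
    Function.Injective (fun v => Matrix.vecMul v (sylvester f g)) ↔
      ∃ p q : OreExtension σ δ, p * f + q * g = 1 := by
  have hg0 := ne_zero_of_natDegree_pos hg
  constructor
  · intro hinj
    obtain ⟨v, hv⟩ := (vecMul_injective_iff_surjective _).1 hinj
      (fun j => coeff (1 : OreExtension σ δ) j)
    refine ⟨ofVec fun i => v (Fin.castAdd _ i), ofVec fun i => v (Fin.natAdd _ i),
      ext fun j => ?_⟩
    rcases lt_or_ge j (natDegree g + natDegree f) with hj | hj
    · rw [← congrFun hv ⟨j, hj⟩]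
      exact (vecMul_sylvester f g v ⟨j, hj⟩).symm
    · rw [coeff_combination_eq_zero (fun i => coeff_ofVec_of_le _)
        (fun i => coeff_ofVec_of_le _) hj, coeff_one, if_neg (by omega)]
  · rintro ⟨u, w, huw⟩
    by_contra hinj
    have hnot := hinj
    rw [vecMul_injective_iff] at hnot
    push Not at hnot
    obtain ⟨v, hv, hv0⟩ := hnot
    set P : OreExtension σ δ := ofVec fun i => v (Fin.castAdd _ i) with hP
    set Q : OreExtension σ δ := ofVec fun i => v (Fin.natAdd _ i) with hQ
    have hPdeg : ∀ i, natDegree g ≤ i → coeff P i = 0 := fun i => coeff_ofVec_of_le _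
    have hQdeg : ∀ i, natDegree f ≤ i → coeff Q i = 0 := fun i => coeff_ofVec_of_le _
    have hPQ : P * f + Q * g = 0 := by
      ext j
      rcases lt_or_ge j (natDegree g + natDegree f) with hj | hj
      · exact (vecMul_sylvester f g v ⟨j, hj⟩).symm.trans (congrFun hv ⟨j, hj⟩)
      · exact coeff_combination_eq_zero hPdeg hQdeg hj
    -- `P = 0` would give `Q g = 0`, so `Q = 0` and `v = 0`.
    have hP0 : P ≠ 0 := by
      intro h0
      have hQ0 : Q = 0 := by
        rw [h0, zero_mul, zero_add] at hPQ
        exact (mul_eq_zero.1 hPQ).resolve_right hg0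
      apply hv0
      ext i
      refine Fin.addCases (fun i => ?_) (fun i => ?_) i
      · rw [← coeff_ofVec (δ := δ) (fun i => v (Fin.castAdd _ i)) i, ← hP, h0]
        rfl
      · rw [← coeff_ofVec (δ := δ) (fun i => v (Fin.natAdd _ i)) i, ← hQ, hQ0]
        rfl
    have hPlt : natDegree P < natDegree g := by
      by_contra hle
      exact coeff_natDegree_ne_zero hP0 (hPdeg _ (not_lt.1 hle))
    -- The contradiction comes from surjectivity: the target `h` equals `(h u) f + (h w) g`, and
    -- subtracting `t` times the relation `P f + Q g = 0` changes the cofactors but not the sum.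
    refine hinj ((vecMul_injective_iff_surjective _).2 fun y => ?_)
    set h : OreExtension σ δ := ofVec y with hh
    obtain ⟨t, ht⟩ := exists_quotient hP0 (h * u)
    set r := h * u - t * P with hr
    set s := h * w - t * Q with hs
    have hrs : r * f + s * g = h := by
      calc r * f + s * g = h * (u * f + w * g) - t * (P * f + Q * g) := by
            rw [hr, hs]; noncomm_ring
        _ = h := by rw [huw, hPQ]; simp
    have hrdeg : ∀ i, natDegree g ≤ i → coeff r i = 0 := fun i hi => ht i (by omega)
    -- The bound on `s` is forced: `s g = h - r f` has no terms in degree `deg f + deg g` or above.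
    have hsdeg : ∀ i, natDegree f ≤ i → coeff s i = 0 := by
      by_contra! hne
      obtain ⟨i, hi, hsi⟩ := hne
      have hs0 : s ≠ 0 := fun e => hsi (by rw [e, coeff_zero])
      have hle := le_natDegree hsi
      refine coeff_mul_natDegree_add_ne_zero hs0 hg0 ?_
      rw [eq_sub_of_add_eq' hrs, coeff_sub, coeff_ofVec_of_le y (by omega),
        coeff_mul_eq_zero hrdeg (by omega), sub_zero]
    refine ⟨Fin.append (fun i => coeff r i) (fun i => coeff s i), ?_⟩
    ext j
    change Matrix.vecMul _ _ j = _
    rw [vecMul_sylvester]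
    simp only [Fin.append_left, Fin.append_right]
    rw [ofVec_coeff hrdeg, ofVec_coeff hsdeg, hrs, hh, coeff_ofVec]

theorem resultant_ne_zero_iff {f g : OreExtension σ δ} (hf : 0 < natDegree f)
    (hg : 0 < natDegree g) :
    resultant f g ≠ 0 ↔ ∃ p q : OreExtension σ δ, p * f + q * g = 1 :=
  (dieudonneDet_ne_zero_iff _ _).trans (vecMul_sylvester_injective_iff hf hg)

theorem span_sup_span_eq_top_iff (f g : OreExtension σ δ) :
    Ideal.span {f} ⊔ Ideal.span {g} = (⊤ : Ideal (OreExtension σ δ)) ↔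
      ∃ p q : OreExtension σ δ, p * f + q * g = 1 := by
  rw [Ideal.eq_top_iff_one, Submodule.mem_sup]
  simp only [Ideal.mem_span_singleton']
  constructor
  · rintro ⟨_, ⟨p, rfl⟩, _, ⟨q, rfl⟩, h⟩
    exact ⟨p, q, h⟩
  · rintro ⟨p, q, h⟩
    exact ⟨_, ⟨p, rfl⟩, _, ⟨q, rfl⟩, h⟩

end OreExtension

end

/-! ### The equivalences -/

theorem theorem3p5 {F : Type*} [DivisionRing F] (σ : F →+* F) (δ : SkewDerivation σ)
    (f g : OreExtension σ δ) (hf : 0 < f.natDegree) (hg : 0 < g.natDegree) :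
    List.TFAE [
      OreExtension.resultant f g = 0,
      ∃ h : OreExtension σ δ, ¬ IsUnit h ∧
        OreExtension.IsRightFactor h f ∧ OreExtension.IsRightFactor h g,
      OreExtension.gcrd f g ≠ 1,
      ¬ ∃ p q : OreExtension σ δ, p * f + q * g = 1,
      Ideal.span {f} ⊔ Ideal.span {g} < (⊤ : Ideal (OreExtension σ δ))] := by
  have hf0 := OreExtension.ne_zero_of_natDegree_pos hf
  have hd : OreExtension.IsGCRD f g (OreExtension.gcrd f g) ∧
      (OreExtension.gcrd f g = 0 ∨ OreExtension.Monic (OreExtension.gcrd f g)) :=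
    (OreExtension.exists_gcrd f g).choose_spec
  tfae_have 1 ↔ 4 := by
    rw [← OreExtension.resultant_ne_zero_iff hf hg, not_not]
  tfae_have 4 ↔ 5 := by
    rw [← OreExtension.span_sup_span_eq_top_iff, lt_top_iff_ne_top]
  tfae_have 2 → 4 := by
    rintro ⟨h, hh, ⟨a, ha⟩, ⟨b, hb⟩⟩ ⟨p, q, hpq⟩
    refine hh (OreExtension.isUnit_of_mul_eq_one_left (p := p * a + q * b) ?_)
    rw [add_mul, mul_assoc, mul_assoc, ← ha, ← hb, hpq]
  tfae_have 3 → 2 := by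
    intro hne
    refine ⟨OreExtension.gcrd f g, fun hu => ?_, hd.1.1, hd.1.2.1⟩
    rcases hd.2 with h0 | hm
    · obtain ⟨q, hq⟩ := hd.1.1
      exact hf0 (by rw [hq, h0, mul_zero])
    · exact hne (hm.eq_one_of_isUnit hu)
  tfae_have 4 → 3 := by
    rintro hno h1
    -- `gcrd` is known only by its universal property. Applied to a common right factor of the form
    -- `p f + q g`, it yields a Bézout identity for `gcrd f g = 1`.
    obtain ⟨p, q, hpf, hqg⟩ := OreExtension.exists_combination_isRightFactor g hf0
    obtain ⟨t, ht⟩ := hd.1.2.2 _ hpf hqg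
    rw [h1] at ht
    exact hno ⟨t * p, t * q, by rw [mul_assoc, mul_assoc, ← mul_add, ← ht]⟩
  tfae_finish
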